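/- Let $G=(A,B,E)$ be a finite simple bipartite graph, i.e. its vertex set $V$ is the disjoint union of $A$ and $B$ and every edge joins a vertex of $A$ to a vertex of $B$. For $X\subseteq V$ let $N(X)$ be the set of vertices having a neighbour in $X$, and let $d(X)=|X|-|N(X)|$. Let $\alpha(G)$ be the maximum size of an independent set of $G$. An independent set $S$ is called critical independent if $d(S)=\max\{d(I): I\subseteq V \text{ independent}\}$; let $\ker(G)$ be the intersection and $\mathrm{diadem}(G)$ the union of all critical independent sets of $G$. A set $X\subseteq A$ is called $A$-critical if $d(X)=\max\{d(X'):X'\subseteq A\}$; let $\ker_A(G)$ be the intersection and $\mathrm{diadem}_A(G)$ the union of all $A$-critical sets. Define $B$-critical sets, $\ker_B(G)$ and $\mathrm{diadem}_B(G)$ in the same way with $B$ in place of $A$. Then: (i) $\ker_A(G)\cup\ker_B(G)=\ker(G)$; (ii) $|\ker(G)|+|\mathrm{diadem}(G)|=2\alpha(G)$; (iii) $|\ker_A(G)|+|\mathrm{diadem}_B(G)|=|\ker_B(G)|+|\mathrm{diadem}_A(G)|=\alpha(G)$; (iv) $\mathrm{diadem}_A(G)\cup\mathrm{diadem}_B(G)=\mathrm{diadem}(G)$.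 -/

import Mathlib

namespace SimpleGraph

variable {V : Type*} [Fintype V] [DecidableEq V] (G : SimpleGraph V) [DecidableRel G.Adj]

/-- The neighborhood `N(X) = {v ∈ V : N(v) ∩ X ≠ ∅}` of a set `X` of vertices. -/
def nbhd (X : Finset V) : Finset V :=
  Finset.univ.filter fun v => (G.neighborFinset v ∩ X).Nonempty

/-- The difference `d(X) = |X| - |N(X)|` of a set `X` of vertices, an integer. When `X` lies in
one side of a bipartite graph this is also called the deficiency `δ(X)` of `X`. -/
def difference (X : Finset V) : ℤ :=
  (X.card : ℤ) - ((G.nbhd X).card : ℤ)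

/-- The family `Ind(G)` of all independent sets of `G`. -/
def indepSets : Finset (Finset V) :=
  Finset.univ.filter fun S => G.IsIndepSet (S : Set V)

theorem empty_mem_indepSets : ∅ ∈ G.indepSets := by
  simp [indepSets]

/-- The critical independence difference `id_c(G) = max {d(I) : I ∈ Ind(G)}`. -/
def criticalIndepDifference : ℤ :=
  G.indepSets.sup' ⟨∅, G.empty_mem_indepSets⟩ G.difference

/-- `S` is a critical independent set: it is independent and `d(S) = id_c(G)`. -/
def IsCriticalIndep (S : Finset V) : Prop :=
  G.IsIndepSet (S : Set V) ∧ G.difference S = G.criticalIndepDifference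

instance : DecidablePred G.IsCriticalIndep := fun S =>
  inferInstanceAs (Decidable (G.IsIndepSet (S : Set V) ∧ G.difference S = G.criticalIndepDifference))

/-- `ker(G)`: the intersection of all critical independent sets. -/
def critKer : Finset V :=
  Finset.univ.filter fun v => ∀ S : Finset V, G.IsCriticalIndep S → v ∈ S

/-- `diadem(G)`: the union of all critical independent sets. -/
def diadem : Finset V :=
  Finset.univ.filter fun v => ∃ S : Finset V, G.IsCriticalIndep S ∧ v ∈ S

/-- `δ₀(A) = max {δ(X) : X ⊆ A}`. -/
def maxDeficiency (A : Finset V) : ℤ :=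
  A.powerset.sup' ⟨∅, Finset.empty_mem_powerset A⟩ G.difference

/-- `X` is `A`-critical: `X ⊆ A` and `δ(X) = δ₀(A)`. -/
def IsSideCritical (A X : Finset V) : Prop :=
  X ⊆ A ∧ G.difference X = G.maxDeficiency A

instance (A : Finset V) : DecidablePred (G.IsSideCritical A) := fun X =>
  inferInstanceAs (Decidable (X ⊆ A ∧ G.difference X = G.maxDeficiency A))

/-- `ker_A(G)`: the intersection of all `A`-critical sets. -/
def sideKer (A : Finset V) : Finset V :=
  Finset.univ.filter fun v => ∀ X : Finset V, G.IsSideCritical A X → v ∈ X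

/-- `diadem_A(G)`: the union of all `A`-critical sets. -/
def sideDiadem (A : Finset V) : Finset V :=
  Finset.univ.filter fun v => ∃ X : Finset V, G.IsSideCritical A X ∧ v ∈ X

end SimpleGraph

namespace SimpleGraph

/-! For `X ⊆ A` the set `X ∪ (B \ N(X))` is independent of size `|B| + d(X)`, so `α = |B| + δ₀(A)`,
and symmetrically for `B`. Hence `X ↦ B \ N(X)` takes `A`-critical sets to `B`-critical ones. It
reverses inclusion, so it sends the least `A`-critical set `ker_A` to the union `diadem_B`; counting
gives (iii). Since `d` is additive across the two sides, critical independent sets restrict to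
critical sets on each side, and every side-critical set extends to one. This gives (i) and (iv), and
(ii) follows by summing. -/

theorem IsBipartiteWith.disjoint_finset {V : Type*} {G : SimpleGraph V} {A B : Finset V}
    (hG : G.IsBipartiteWith (A : Set V) (B : Set V)) : Disjoint A B :=
  Finset.disjoint_coe.1 hG.disjoint

section Critical

variable {V : Type*} [Fintype V] [DecidableEq V] {G : SimpleGraph V} [DecidableRel G.Adj]
  {A B S X Y : Finset V}

theorem mem_nbhd {v : V} : v ∈ G.nbhd X ↔ ∃ u ∈ X, G.Adj v u := by
  simp only [nbhd, Finset.mem_filter, Finset.mem_univ, true_and, Finset.Nonempty,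
    Finset.mem_inter, mem_neighborFinset]
  exact ⟨fun ⟨u, h, hu⟩ => ⟨u, hu, h⟩, fun ⟨u, hu, h⟩ => ⟨u, h, hu⟩⟩

theorem nbhd_mono (h : X ⊆ Y) : G.nbhd X ⊆ G.nbhd Y := fun _ hv => by
  obtain ⟨u, hu, huv⟩ := mem_nbhd.1 hv
  exact mem_nbhd.2 ⟨u, h hu, huv⟩

theorem nbhd_union : G.nbhd (X ∪ Y) = G.nbhd X ∪ G.nbhd Y := by
  ext v
  simp only [mem_nbhd, Finset.mem_union, or_and_right, exists_or]

/-- The difference function is supermodular. -/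
theorem difference_add_le :
    G.difference X + G.difference Y ≤ G.difference (X ∩ Y) + G.difference (X ∪ Y) := by
  have h₁ := Finset.card_union_add_card_inter X Y
  have h₂ := Finset.card_union_add_card_inter (G.nbhd X) (G.nbhd Y)
  have h₃ : (G.nbhd (X ∩ Y)).card ≤ (G.nbhd X ∩ G.nbhd Y).card :=
    Finset.card_le_card (Finset.subset_inter (nbhd_mono Finset.inter_subset_left)
      (nbhd_mono Finset.inter_subset_right))
  simp only [difference, nbhd_union]
  omega

theorem difference_le_maxDeficiency (h : X ⊆ A) : G.difference X ≤ G.maxDeficiency A :=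
  Finset.le_sup' G.difference (Finset.mem_powerset.2 h)

theorem isSideCritical_of_le (h : X ⊆ A) (hX : G.maxDeficiency A ≤ G.difference X) :
    G.IsSideCritical A X :=
  ⟨h, (difference_le_maxDeficiency h).antisymm hX⟩

theorem exists_isSideCritical (G : SimpleGraph V) [DecidableRel G.Adj] (A : Finset V) :
    ∃ X, G.IsSideCritical A X := by
  obtain ⟨X, hX, h⟩ := Finset.exists_mem_eq_sup' ⟨∅, Finset.empty_mem_powerset A⟩ G.difference
  exact ⟨X, Finset.mem_powerset.1 hX, h.symm⟩

theorem IsSideCritical.inter (hX : G.IsSideCritical A X) (hY : G.IsSideCritical A Y) :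
    G.IsSideCritical A (X ∩ Y) := by
  refine isSideCritical_of_le (Finset.inter_subset_left.trans hX.1) ?_
  have h₁ := difference_add_le (G := G) (X := X) (Y := Y)
  have h₂ := difference_le_maxDeficiency (G := G) (Finset.union_subset hX.1 hY.1)
  have h₃ := hX.2
  have h₄ := hY.2
  omega

theorem mem_sideKer {v : V} : v ∈ G.sideKer A ↔ ∀ X, G.IsSideCritical A X → v ∈ X := by
  simp [sideKer]

theorem mem_sideDiadem {v : V} :
    v ∈ G.sideDiadem A ↔ ∃ X, G.IsSideCritical A X ∧ v ∈ X := by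
  simp [sideDiadem]

theorem mem_critKer {v : V} : v ∈ G.critKer ↔ ∀ S, G.IsCriticalIndep S → v ∈ S := by
  simp [critKer]

theorem mem_diadem {v : V} : v ∈ G.diadem ↔ ∃ S, G.IsCriticalIndep S ∧ v ∈ S := by
  simp [diadem]

theorem sideKer_subset_of_isSideCritical (h : G.IsSideCritical A X) : G.sideKer A ⊆ X :=
  fun _ hv => mem_sideKer.1 hv X h

theorem sideKer_subset : G.sideKer A ⊆ A := by
  obtain ⟨X, hX⟩ := exists_isSideCritical G A
  exact (sideKer_subset_of_isSideCritical hX).trans hX.1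

theorem sideDiadem_subset : G.sideDiadem A ⊆ A := fun _ hv => by
  obtain ⟨X, hX, hvX⟩ := mem_sideDiadem.1 hv
  exact hX.1 hvX

theorem isSideCritical_sideKer (G : SimpleGraph V) [DecidableRel G.Adj] (A : Finset V) :
    G.IsSideCritical A (G.sideKer A) := by
  -- A critical set of least size lies in every other one, because critical sets are closed under
  -- intersection.
  obtain ⟨X, hX, hmin⟩ := Finset.exists_min_image
    (Finset.univ.filter (G.IsSideCritical A)) Finset.card
    ((exists_isSideCritical G A).imp fun X hX => by simpa using hX)
  simp only [Finset.mem_filter, Finset.mem_univ, true_and] at hX hmin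
  have : G.sideKer A = X := by
    refine (sideKer_subset_of_isSideCritical hX).antisymm fun v hv => mem_sideKer.2 fun Y hY => ?_
    have := Finset.eq_of_subset_of_card_le Finset.inter_subset_left (hmin _ (hX.inter hY))
    exact Finset.inter_subset_right (this ▸ hv)
  rwa [this]

theorem IsBipartiteWith.nbhd_subset (hG : G.IsBipartiteWith (A : Set V) (B : Set V))
    (h : X ⊆ A) : G.nbhd X ⊆ B := fun v hv => by
  obtain ⟨u, hu, huv⟩ := mem_nbhd.1 hv
  exact_mod_cast hG.mem_of_mem_adj (Finset.mem_coe.2 (h hu)) huv.symm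

theorem isIndepSet_iff_disjoint_nbhd : G.IsIndepSet (S : Set V) ↔ Disjoint S (G.nbhd S) := by
  rw [Finset.disjoint_left]
  constructor
  · intro h v hv hv'
    obtain ⟨u, hu, huv⟩ := mem_nbhd.1 hv'
    exact h hv hu huv.ne huv
  · intro h v hv u hu _ huv
    exact h hv (mem_nbhd.2 ⟨u, hu, huv⟩)

theorem nbhd_sdiff_nbhd_subset (hG : G.IsBipartiteWith (A : Set V) (B : Set V)) :
    G.nbhd (B \ G.nbhd X) ⊆ A \ X := fun v hv => by
  refine Finset.mem_sdiff.2 ⟨hG.symm.nbhd_subset Finset.sdiff_subset hv, fun hvX => ?_⟩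
  obtain ⟨u, hu, huv⟩ := mem_nbhd.1 hv
  exact (Finset.mem_sdiff.1 hu).2 (mem_nbhd.2 ⟨v, hvX, huv.symm⟩)

/-- A set on one side together with its non-neighbours on the other side is independent. -/
theorem isIndepSet_union_sdiff_nbhd (hG : G.IsBipartiteWith (A : Set V) (B : Set V))
    (hX : X ⊆ A) : G.IsIndepSet ((X ∪ (B \ G.nbhd X) : Finset V) : Set V) := by
  have hd := Finset.disjoint_left.1 hG.disjoint_finset
  rw [isIndepSet_iff_disjoint_nbhd, nbhd_union, Finset.disjoint_left]
  intro v hv hv'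
  rcases Finset.mem_union.1 hv with hv | hv <;> rcases Finset.mem_union.1 hv' with hv' | hv'
  · exact hd (hX hv) (hG.nbhd_subset hX hv')
  · exact (Finset.mem_sdiff.1 (nbhd_sdiff_nbhd_subset hG hv')).2 hv
  · exact (Finset.mem_sdiff.1 hv).2 hv'
  · exact hd (Finset.mem_sdiff.1 (nbhd_sdiff_nbhd_subset hG hv')).1 (Finset.mem_sdiff.1 hv).1

theorem card_union_sdiff_nbhd (hG : G.IsBipartiteWith (A : Set V) (B : Set V)) (hX : X ⊆ A) :
    ((X ∪ (B \ G.nbhd X)).card : ℤ) = B.card + G.difference X := by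
  rw [Finset.card_union_of_disjoint (hG.disjoint_finset.mono hX Finset.sdiff_subset),
    Finset.card_sdiff_of_subset (hG.nbhd_subset hX)]
  have := Finset.card_le_card (hG.nbhd_subset hX)
  simp only [difference]
  omega

theorem inter_union_inter_of_union_eq_univ (hAB : A ∪ B = Finset.univ) :
    S ∩ A ∪ S ∩ B = S := by
  rw [← Finset.inter_union_distrib_left, hAB, Finset.inter_univ]

theorem IsIndepSet.inter_subset_sdiff_nbhd (hS : G.IsIndepSet (S : Set V)) :
    S ∩ B ⊆ B \ G.nbhd (S ∩ A) := fun _ hv =>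
  Finset.mem_sdiff.2 ⟨(Finset.mem_inter.1 hv).2, fun hv' =>
    Finset.disjoint_left.1 (isIndepSet_iff_disjoint_nbhd.1 hS) (Finset.mem_inter.1 hv).1
      (nbhd_mono Finset.inter_subset_left hv')⟩

theorem indepNum_eq_card_add_maxDeficiency (hG : G.IsBipartiteWith (A : Set V) (B : Set V))
    (hAB : A ∪ B = Finset.univ) : (G.indepNum : ℤ) = B.card + G.maxDeficiency A := by
  apply le_antisymm
  · obtain ⟨S, hS⟩ := G.exists_isNIndepSet_indepNum
    have hsub : S ⊆ S ∩ A ∪ (B \ G.nbhd (S ∩ A)) := by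
      conv_lhs => rw [← inter_union_inter_of_union_eq_univ (S := S) hAB]
      exact Finset.union_subset_union_right hS.isIndepSet.inter_subset_sdiff_nbhd
    have h₁ := Finset.card_le_card hsub
    have h₂ := card_union_sdiff_nbhd hG (Finset.inter_subset_right : S ∩ A ⊆ A)
    have h₃ := difference_le_maxDeficiency (G := G) (Finset.inter_subset_right : S ∩ A ⊆ A)
    have h₄ := hS.card_eq
    omega
  · obtain ⟨X, hX⟩ := exists_isSideCritical G A
    rw [← hX.2, ← card_union_sdiff_nbhd hG hX.1]
    exact_mod_cast (isIndepSet_union_sdiff_nbhd hG hX.1).card_le_indepNum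

/-- The non-neighbours of an `A`-critical set form a `B`-critical set. -/
theorem IsSideCritical.sdiff_nbhd (hG : G.IsBipartiteWith (A : Set V) (B : Set V))
    (hAB : A ∪ B = Finset.univ) (hX : G.IsSideCritical A X) :
    G.IsSideCritical B (B \ G.nbhd X) := by
  refine isSideCritical_of_le Finset.sdiff_subset ?_
  -- The two formulas for `α` give `δ₀(B) = δ₀(A) + |A| - |B|`, and `N(B \ N(X)) ⊆ A \ X` shows that
  -- `d(B \ N(X))` is at least this.
  have h₁ := indepNum_eq_card_add_maxDeficiency hG hAB
  have h₂ := indepNum_eq_card_add_maxDeficiency hG.symm (Finset.union_comm A B ▸ hAB)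
  have h₃ := Finset.card_le_card (nbhd_sdiff_nbhd_subset (X := X) hG)
  have h₄ := Finset.card_sdiff_add_card_eq_card hX.1
  have h₅ := Finset.card_sdiff_add_card_eq_card (hG.nbhd_subset hX.1)
  have h₆ := hX.2
  simp only [difference] at h₆ ⊢
  omega

theorem sideDiadem_eq_sdiff_nbhd_sideKer (hG : G.IsBipartiteWith (A : Set V) (B : Set V))
    (hAB : A ∪ B = Finset.univ) : G.sideDiadem B = B \ G.nbhd (G.sideKer A) := by
  apply Finset.Subset.antisymm
  · intro v hv
    obtain ⟨Y, hY, hvY⟩ := mem_sideDiadem.1 hv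
    refine Finset.mem_sdiff.2 ⟨hY.1 hvY, fun hv' => ?_⟩
    obtain ⟨u, hu, huv⟩ := mem_nbhd.1 hv'
    -- `A \ N(Y)` is `A`-critical, so it contains `ker_A`; thus no vertex of `ker_A` has a neighbour
    -- in `Y`.
    have := mem_sideKer.1 hu _ (hY.sdiff_nbhd hG.symm (Finset.union_comm A B ▸ hAB))
    exact (Finset.mem_sdiff.1 this).2 (mem_nbhd.2 ⟨v, hvY, huv.symm⟩)
  · exact fun v hv =>
      mem_sideDiadem.2 ⟨_, (isSideCritical_sideKer G A).sdiff_nbhd hG hAB, hv⟩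

theorem card_sideKer_add_card_sideDiadem (hG : G.IsBipartiteWith (A : Set V) (B : Set V))
    (hAB : A ∪ B = Finset.univ) :
    (G.sideKer A).card + (G.sideDiadem B).card = G.indepNum := by
  rw [← Finset.card_union_of_disjoint
    (hG.disjoint_finset.mono sideKer_subset sideDiadem_subset)]
  have h₁ := card_union_sdiff_nbhd hG (sideKer_subset (G := G) (A := A))
  rw [(isSideCritical_sideKer G A).2, ← indepNum_eq_card_add_maxDeficiency hG hAB,
    ← sideDiadem_eq_sdiff_nbhd_sideKer hG hAB] at h₁
  exact_mod_cast h₁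

theorem difference_union_of_subset (hG : G.IsBipartiteWith (A : Set V) (B : Set V))
    (hX : X ⊆ A) (hY : Y ⊆ B) :
    G.difference (X ∪ Y) = G.difference X + G.difference Y := by
  have h₁ := Finset.card_union_of_disjoint (hG.disjoint_finset.mono hX hY)
  have h₂ := Finset.card_union_of_disjoint
    (hG.symm.disjoint_finset.mono (hG.nbhd_subset hX) (hG.symm.nbhd_subset hY))
  simp only [difference, nbhd_union]
  omega

/-- Additivity bounds `d(S)` for every `S`, independent or not; the independent set `X ∪ (B \ N(X))`
with `X` critical attains both side maxima at once. -/
theorem criticalIndepDifference_eq (hG : G.IsBipartiteWith (A : Set V) (B : Set V))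
    (hAB : A ∪ B = Finset.univ) :
    G.criticalIndepDifference = G.maxDeficiency A + G.maxDeficiency B := by
  apply le_antisymm
  · refine Finset.sup'_le _ _ fun S _ => ?_
    rw [← inter_union_inter_of_union_eq_univ (S := S) hAB,
      difference_union_of_subset hG Finset.inter_subset_right Finset.inter_subset_right]
    exact add_le_add (difference_le_maxDeficiency Finset.inter_subset_right)
      (difference_le_maxDeficiency Finset.inter_subset_right)
  · obtain ⟨X, hX⟩ := exists_isSideCritical G A
    have hY := hX.sdiff_nbhd hG hAB
    rw [← hX.2, ← hY.2, ← difference_union_of_subset hG hX.1 hY.1]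
    refine Finset.le_sup' G.difference ?_
    simpa [indepSets] using isIndepSet_union_sdiff_nbhd hG hX.1

theorem IsSideCritical.isCriticalIndep_union (hG : G.IsBipartiteWith (A : Set V) (B : Set V))
    (hAB : A ∪ B = Finset.univ) (hX : G.IsSideCritical A X) :
    G.IsCriticalIndep (X ∪ (B \ G.nbhd X)) := by
  have hY := hX.sdiff_nbhd hG hAB
  refine ⟨isIndepSet_union_sdiff_nbhd hG hX.1, ?_⟩
  rw [difference_union_of_subset hG hX.1 hY.1, hX.2, hY.2, criticalIndepDifference_eq hG hAB]

theorem IsCriticalIndep.isSideCritical_inter (hG : G.IsBipartiteWith (A : Set V) (B : Set V))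
    (hAB : A ∪ B = Finset.univ) (hS : G.IsCriticalIndep S) : G.IsSideCritical A (S ∩ A) := by
  refine isSideCritical_of_le Finset.inter_subset_right ?_
  have h₁ := hS.2
  rw [← inter_union_inter_of_union_eq_univ (S := S) hAB, criticalIndepDifference_eq hG hAB,
    difference_union_of_subset hG Finset.inter_subset_right Finset.inter_subset_right] at h₁
  -- The two traces reach the sum of the two maxima, so neither can fall short of its own.
  have h₂ := difference_le_maxDeficiency (G := G) (Finset.inter_subset_right : S ∩ B ⊆ B)
  omega

theorem critKer_inter_eq_sideKer (hG : G.IsBipartiteWith (A : Set V) (B : Set V))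
    (hAB : A ∪ B = Finset.univ) : G.critKer ∩ A = G.sideKer A := by
  ext v
  rw [Finset.mem_inter, mem_critKer, mem_sideKer]
  constructor
  · rintro ⟨hv, hvA⟩ X hX
    rcases Finset.mem_union.1 (hv _ (hX.isCriticalIndep_union hG hAB)) with h | h
    · exact h
    · exact absurd (Finset.mem_sdiff.1 h).1 (Finset.disjoint_left.1 hG.disjoint_finset hvA)
  · exact fun hv => ⟨fun S hS => (Finset.mem_inter.1 (hv _ (hS.isSideCritical_inter hG hAB))).1,
      sideKer_subset (mem_sideKer.2 hv)⟩

theorem diadem_inter_eq_sideDiadem (hG : G.IsBipartiteWith (A : Set V) (B : Set V))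
    (hAB : A ∪ B = Finset.univ) : G.diadem ∩ A = G.sideDiadem A := by
  ext v
  rw [Finset.mem_inter, mem_diadem, mem_sideDiadem]
  constructor
  · rintro ⟨⟨S, hS, hv⟩, hvA⟩
    exact ⟨_, hS.isSideCritical_inter hG hAB, Finset.mem_inter.2 ⟨hv, hvA⟩⟩
  · rintro ⟨X, hX, hv⟩
    exact ⟨⟨_, hX.isCriticalIndep_union hG hAB, Finset.mem_union_left _ hv⟩, hX.1 hv⟩

end Critical

end SimpleGraph

open SimpleGraph in
theorem mainTheorem2 {V : Type*} [Fintype V] [DecidableEq V]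
    (G : SimpleGraph V) [DecidableRel G.Adj] (A B : Finset V)
    (hG : G.IsBipartiteWith (A : Set V) (B : Set V)) (hAB : A ∪ B = Finset.univ) :
    G.sideKer A ∪ G.sideKer B = G.critKer ∧
    G.critKer.card + G.diadem.card = 2 * G.indepNum ∧
    ((G.sideKer A).card + (G.sideDiadem B).card = G.indepNum ∧
      (G.sideKer B).card + (G.sideDiadem A).card = G.indepNum) ∧
    G.sideDiadem A ∪ G.sideDiadem B = G.diadem := by
  have hBA : B ∪ A = Finset.univ := Finset.union_comm A B ▸ hAB
  have hker : G.sideKer A ∪ G.sideKer B = G.critKer := by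
    rw [← critKer_inter_eq_sideKer hG hAB, ← critKer_inter_eq_sideKer hG.symm hBA,
      inter_union_inter_of_union_eq_univ hAB]
  have hdia : G.sideDiadem A ∪ G.sideDiadem B = G.diadem := by
    rw [← diadem_inter_eq_sideDiadem hG hAB, ← diadem_inter_eq_sideDiadem hG.symm hBA,
      inter_union_inter_of_union_eq_univ hAB]
  have h₁ := card_sideKer_add_card_sideDiadem hG hAB
  have h₂ := card_sideKer_add_card_sideDiadem hG.symm hBA
  refine ⟨hker, ?_, ⟨h₁, h₂⟩, hdia⟩
  rw [← hker, ← hdia,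
    Finset.card_union_of_disjoint (hG.disjoint_finset.mono sideKer_subset sideKer_subset),
    Finset.card_union_of_disjoint (hG.disjoint_finset.mono sideDiadem_subset sideDiadem_subset)]
  omega
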